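/- Let $\operatorname{sgn}(0)=0$ and let $$H_0(x)=\Big(\frac{\sin\pi x}{\pi}\Big)^2\Big\{\sum_{m=-\infty}^{\infty}\frac{\operatorname{sgn}(m)}{(x-m)^2}+\frac2x\Big\},\qquad H_1(x)=\Big(\frac{\sin \pi x}{\pi x}\Big)^2,$$ extended by continuity to $x\in\mathbb Z$, and put $H^{\pm}=H_0\pm H_1$. For $\beta>0$ let $$r_\beta^{\pm}(x)=\tfrac12\big\{H^{\pm}(x+\beta)+H^{\pm}(-x+\beta)\big\}\qquad(x\in\mathbb R)$$ be the Beurling–Selberg majorant and minorant of $\chi_{[-\beta,\beta]}$, and for integrable $R$ let $$M(R)=\int_{-\infty}^{\infty}R(x)\Big\{1-\Big(\frac{\sin\pi x}{\pi x}\Big)^2\Big\}\,dx .$$ Then for every $\beta>0$ and either choice of sign, $r_\beta^{\pm}$ is integrable on $\mathbb R$ and $$\tfrac12 M(r_\beta^{\pm})=\Big(\beta\pm\frac12\Big)-\frac1{2\pi^2\beta}+\frac{\sin2\pi\beta}{4\pi^3\beta^2}-\frac1{4\pi^2}\sum_{n\in\mathbb Z}\frac{\operatorname{sgn}(n^{\pm})}{(n-\beta)^2}\Big(2+\frac{\sin2\pi\beta}{\pi(n-\beta)}\Big),$$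 where $\operatorname{sgn}(n^\pm)=\operatorname{sgn}(n)$ for $n\neq0$ and $\operatorname{sgn}(0^{\pm})=\pm1$, the series converges absolutely, and, if $\beta$ is an integer, $\frac{1}{(n-\beta)^2}\big(2+\frac{\sin 2\pi\beta}{\pi(n-\beta)}\big)$ for $n=\beta$ stands for its limiting value $4\pi^2/3$. Moreover $$\tfrac12 M(r_\beta^{\pm})=\beta-\frac12\pm\frac12+\frac1{2\pi^2\beta}+O\Big(\frac1{\beta^2}\Big),$$ with an absolute implied constant, uniformly for $\beta>0$. -/

import Mathlib

noncomputable section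

namespace BeurlingSelberg

/-- `H₀(x) = (sin πx / π)² { ∑_{m ∈ ℤ} sgn(m) / (x - m)² + 2 / x }` on the real line. The
singularities at the integers are removable, and there the function takes the limiting value, which
is `sgn(x)` (with `sgn(0) = 0`). -/
def H0 (x : ℝ) : ℝ :=
  open Classical in
  if ∃ n : ℤ, x = n then Real.sign x
  else (Real.sin (Real.pi * x) / Real.pi) ^ 2 *
    ((∑' m : ℤ, Real.sign m / (x - m) ^ 2) + 2 / x)

/-- `H₁(x) = (sin πx / (πx))²`, with `H₁(0) = 1`. -/
def H1 (x : ℝ) : ℝ := Real.sinc (Real.pi * x) ^ 2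

/-- `H^±(x) = H₀(x) ± H₁(x)`; the sign `±` is given by `s = 1` or `s = -1`. -/
def H (s x : ℝ) : ℝ := H0 x + s * H1 x

/-- The functions `r_β^±(x) = ½ { H^±(x + β) + H^±(-x + β) }`; the sign `±` is given by
`s = 1` or `s = -1`. -/
def r (s β x : ℝ) : ℝ := (H s (x + β) + H s (-x + β)) / 2

/-- `M(R) = ∫ R(x) { 1 - (sin πx / (πx))² } dx`. -/
def M (R : ℝ → ℝ) : ℝ :=
  ∫ x : ℝ, R x * (1 - Real.sinc (Real.pi * x) ^ 2)

/-- `sgn(n^±)`: the sign of the integer `n`, with `sgn(0^±) = ±1`. -/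
def sgnPM (s : ℝ) (n : ℤ) : ℝ := if n = 0 then s else Real.sign n

/-- The function `(n - β)⁻² { 2 + sin(2πβ) / (π(n - β)) }` of `β`. Its singularity at `β = n` is
removable, and there it takes the limiting value `4π²/3` (see `tendsto_kernelTerm`). -/
def kernelTerm (n : ℤ) (β : ℝ) : ℝ :=
  open Classical in
  if β = n then 4 * Real.pi ^ 2 / 3
  else 1 / (n - β) ^ 2 * (2 + Real.sin (2 * Real.pi * β) / (Real.pi * (n - β)))

theorem tendsto_kernelTerm (n : ℤ) :
    Filter.Tendsto (kernelTerm n) (nhdsWithin (n : ℝ) {(n : ℝ)}ᶜ)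
      (nhds (4 * Real.pi ^ 2 / 3)) := by
  have hpi := Real.pi_pos
  have hy : Filter.Tendsto (fun β : ℝ => 2 * Real.pi * (n - β))
      (nhdsWithin (n : ℝ) {(n : ℝ)}ᶜ) (nhds 0) := by
    have : Continuous fun β : ℝ => 2 * Real.pi * (n - β) := by fun_prop
    have h := this.tendsto (n : ℝ)
    simp only [sub_self, mul_zero] at h
    exact h.mono_left nhdsWithin_le_nhds
  have hlim : Filter.Tendsto
      (fun β : ℝ => 8 * Real.pi ^ 2 * ((2 * Real.pi * (n - β)) ^ 2 / 100))
      (nhdsWithin (n : ℝ) {(n : ℝ)}ᶜ) (nhds 0) := by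
    have := ((hy.pow 2).div_const 100).const_mul (8 * Real.pi ^ 2)
    simpa using this
  rw [tendsto_iff_norm_sub_tendsto_zero]
  refine squeeze_zero' (Filter.Eventually.of_forall fun _ => norm_nonneg _) ?_ hlim
  have hsmall : ∀ᶠ β in nhdsWithin (n : ℝ) {(n : ℝ)}ᶜ, |2 * Real.pi * (n - β)| < 1 := by
    have := hy.abs
    rw [abs_zero] at this
    exact this.eventually_lt_const one_pos
  filter_upwards [hsmall, self_mem_nhdsWithin] with β hβ hne
  have hne' : β ≠ n := hne
  have hs : Real.sin (2 * Real.pi * β) = -Real.sin (2 * Real.pi * (n - β)) := by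
    have : 2 * Real.pi * β = n * (2 * Real.pi) - 2 * Real.pi * (n - β) := by ring
    rw [this, Real.sin_int_mul_two_pi_sub]
  have hb := Real.sin_bound hβ.le
  have hne2 : (n : ℝ) - β ≠ 0 := sub_ne_zero.2 hne'.symm
  rw [kernelTerm, if_neg hne', hs]
  set y := 2 * Real.pi * (n - β) with hydef
  have hy0 : y ≠ 0 := by positivity
  have hny : (n : ℝ) - β = y / (2 * Real.pi) := by rw [hydef]; field_simp
  have key : 1 / ((n : ℝ) - β) ^ 2 * (2 + -Real.sin y / (Real.pi * (n - β)))
      - 4 * Real.pi ^ 2 / 3 =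
      -(8 * Real.pi ^ 2 / y ^ 3) * (Real.sin y - (y - y ^ 3 / 6)) := by
    rw [hny]
    field_simp
    ring
  rw [key, Real.norm_eq_abs, abs_mul, abs_neg, abs_div, abs_of_pos (by positivity :
    0 < 8 * Real.pi ^ 2), abs_pow]
  have hya : 0 < |y| := abs_pos.2 hy0
  calc 8 * Real.pi ^ 2 / |y| ^ 3 * |Real.sin y - (y - y ^ 3 / 6)|
      ≤ 8 * Real.pi ^ 2 / |y| ^ 3 * (|y| ^ 5 / 100) := by gcongr
    _ = 8 * Real.pi ^ 2 * (y ^ 2 / 100) := by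
      rw [← sq_abs y]
      field_simp

end BeurlingSelberg

end

namespace BeurlingSelberg

open Real FourierTransform MeasureTheory Filter Topology

/-! ### The Fejér kernel and its Fourier transform -/

/-! The Fejér kernel `H1` is the Fourier transform of the tent function and vice versa. Since the
tent vanishes at nonzero integers, Poisson summation makes the integer translates of `H1` a
partition of unity (`hasSum_H1`), and the definition of `H0` reads `H s x = 2 * x * H1 x + ∑ sgnPM s
n * H1 (x - n)`.

Split `M (r s β)` into `∫ r` minus the integral of `r` against `H1`. For the first, `H0 - sign` is
odd and dominated by `H1`, so `H s - sign` is integrable with integral `s`. The two signs in `r`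
combine to the indicator of an interval of length `2 * β`, whence `∫ r = 2 * β + s`. For the second,
evenness of `H1` reduces the integral to that of `H s (x + β) * H1 x`, which is evaluated term by
term on the Fourier side: a translate of `H1` gives a cosine integral of `(1 - t) ^ 2`, that is,
`kernelTerm` (`integral_H1_add_sub_mul_H1`), and `x * H1 x` gives a sine integral of `1 - t`
(`integral_add_mul_H1_add_mul_H1`). This is the exact formula `half_M_r`.

For the asymptotics, integrating the partition of unity gives `∑ kernelTerm n β = 2 * π ^ 2`. Hence
the signed sum differs from `2 * π ^ 2` only through the terms with `n ≤ 0`, which stay at distance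
at least `β` from the singularity and are estimated by telescoping series. -/

theorem H1_nonneg (x : ℝ) : 0 ≤ H1 x := sq_nonneg _

theorem H1_le_one (x : ℝ) : H1 x ≤ 1 := by
  have := abs_sinc_le_one (π * x)
  rw [H1, ← sq_abs]
  exact pow_le_one₀ (abs_nonneg _) this

theorem H1_neg (x : ℝ) : H1 (-x) = H1 x := by simp [H1]

theorem continuous_H1 : Continuous H1 := by
  have := continuous_sinc
  unfold H1
  fun_prop

theorem H1_of_ne_zero {x : ℝ} (hx : x ≠ 0) : H1 x = (sin (π * x) / π) ^ 2 / x ^ 2 := by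
  rw [H1, sinc_of_ne_zero (mul_ne_zero pi_ne_zero hx)]
  field_simp

theorem sq_mul_H1 (x : ℝ) : x ^ 2 * H1 x = (sin (π * x) / π) ^ 2 := by
  rcases eq_or_ne x 0 with rfl | hx
  · simp
  · rw [H1_of_ne_zero hx]
    field_simp

theorem sin_div_pi_sq_le_one (y : ℝ) : (sin y / π) ^ 2 ≤ 1 := by
  have h1 : sin y ^ 2 ≤ 1 := sin_sq_le_one y
  have h2 := pi_gt_three
  rw [div_pow, div_le_one (by positivity)]
  nlinarith

theorem H1_le (x : ℝ) : H1 x ≤ 2 * (1 + x ^ 2)⁻¹ := by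
  rw [← div_eq_mul_inv, le_div_iff₀ (by positivity)]
  nlinarith [H1_le_one x, sq_mul_H1 x, sin_div_pi_sq_le_one (π * x)]

theorem integrable_H1 : Integrable H1 := by
  refine (integrable_inv_one_add_sq.const_mul 2).mono' continuous_H1.aestronglyMeasurable ?_
  exact Eventually.of_forall fun x => by
    rw [norm_eq_abs, abs_of_nonneg (H1_nonneg x)]
    exact H1_le x

/-- The Fourier transform of the Fejér kernel. -/
noncomputable def tent (t : ℝ) : ℝ := max 0 (1 - |t|)

theorem continuous_tent : Continuous tent := by
  unfold tent
  fun_prop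

theorem tent_neg (t : ℝ) : tent (-t) = tent t := by simp [tent]

theorem tent_of_mem {t : ℝ} (h0 : 0 ≤ t) (h1 : t ≤ 1) : tent t = 1 - t := by
  rw [tent, abs_of_nonneg h0, max_eq_right (by linarith)]

theorem tent_of_one_le {t : ℝ} (h : 1 ≤ |t|) : tent t = 0 := by
  rw [tent, max_eq_left (by linarith)]

theorem tent_nonneg (t : ℝ) : 0 ≤ tent t := le_max_left _ _

theorem tent_le_one (t : ℝ) : tent t ≤ 1 := by
  have := abs_nonneg t
  exact max_le zero_le_one (by linarith)

theorem integrable_coe {f : ℝ → ℝ} (hf : Integrable f) : Integrable fun t => (f t : ℂ) := hf.ofReal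

/-- The Fourier transform of a function supported in `[-1, 1]`. -/
theorem fourier_of_support {f : ℝ → ℂ} (hf : Integrable f) (h0 : ∀ t, 1 < |t| → f t = 0)
    (x : ℝ) :
    𝓕 f x = ∫ t in (0 : ℝ)..1, (Complex.exp (((-2 * π * t * x : ℝ) : ℂ) * Complex.I) * f t +
      Complex.exp (((2 * π * t * x : ℝ) : ℂ) * Complex.I) * f (-t)) := by
  rw [fourier_real_eq_integral_exp_smul]
  set g : ℝ → ℂ := fun t => Complex.exp (((-2 * π * t * x : ℝ) : ℂ) * Complex.I) • f t with hg
  have hgi : Integrable g := by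
    refine hf.mono ?_ (Eventually.of_forall fun t => ?_)
    · have hc : Continuous fun t : ℝ => Complex.exp (((-2 * π * t * x : ℝ) : ℂ) * Complex.I) := by
        fun_prop
      exact hc.aestronglyMeasurable.smul hf.aestronglyMeasurable
    · rw [hg, norm_smul, Complex.norm_exp_ofReal_mul_I, one_mul]
  have hs : ∀ t ∉ Set.Icc (-1 : ℝ) 1, g t = 0 := by
    intro t ht
    have : 1 < |t| := by
      by_contra hc
      exact ht (abs_le.1 (not_lt.1 hc))
    simp [hg, h0 t this]
  have hI : ∀ a b : ℝ, IntervalIntegrable g volume a b := fun a b => hgi.intervalIntegrable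
  have hI' : IntervalIntegrable (fun t => g (-t)) volume 0 1 := hgi.comp_neg.intervalIntegrable
  rw [← setIntegral_eq_integral_of_forall_compl_eq_zero hs, integral_Icc_eq_integral_Ioc,
    ← intervalIntegral.integral_of_le (by norm_num),
    ← intervalIntegral.integral_add_adjacent_intervals (hI (-1) 0) (hI 0 1), add_comm]
  have hneg : ∫ t in (-1 : ℝ)..0, g t = ∫ t in (0 : ℝ)..1, g (-t) := by
    rw [intervalIntegral.integral_comp_neg]
    simp
  rw [hneg, ← intervalIntegral.integral_add (hI 0 1) hI']
  refine intervalIntegral.integral_congr fun t _ => ?_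
  simp only [hg, smul_eq_mul]
  congr 4
  push_cast
  ring

theorem fourier_of_even {f : ℝ → ℝ} (hf : Integrable f) (h0 : ∀ t, 1 < |t| → f t = 0)
    (hev : ∀ t, f (-t) = f t) (x : ℝ) :
    𝓕 (fun t => (f t : ℂ)) x = ((2 * ∫ t in (0 : ℝ)..1, f t * cos (2 * π * x * t) : ℝ) : ℂ) := by
  rw [fourier_of_support (integrable_coe hf) (fun t ht => by simp [h0 t ht]),
    ← intervalIntegral.integral_const_mul, ← intervalIntegral.integral_ofReal]
  refine intervalIntegral.integral_congr fun t _ => ?_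
  simp only [hev, Complex.exp_mul_I, ← Complex.ofReal_cos, ← Complex.ofReal_sin]
  rw [show -2 * π * t * x = -(2 * π * x * t) by ring, show 2 * π * t * x = 2 * π * x * t by ring,
    cos_neg, sin_neg]
  push_cast
  ring

theorem fourier_of_odd {f : ℝ → ℝ} (hf : Integrable f) (h0 : ∀ t, 1 < |t| → f t = 0)
    (hodd : ∀ t, f (-t) = -f t) (x : ℝ) :
    𝓕 (fun t => (f t : ℂ)) x =
      ((2 * ∫ t in (0 : ℝ)..1, f t * sin (2 * π * x * t) : ℝ) : ℂ) * -Complex.I := by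
  rw [fourier_of_support (integrable_coe hf) (fun t ht => by simp [h0 t ht]),
    ← intervalIntegral.integral_const_mul, ← intervalIntegral.integral_ofReal,
    ← intervalIntegral.integral_mul_const]
  refine intervalIntegral.integral_congr fun t _ => ?_
  simp only [hodd, Complex.exp_mul_I, ← Complex.ofReal_cos, ← Complex.ofReal_sin]
  rw [show -2 * π * t * x = -(2 * π * x * t) by ring, show 2 * π * t * x = 2 * π * x * t by ring,
    cos_neg, sin_neg]
  push_cast
  ring

theorem hasDerivAt_sin_mul (a t : ℝ) : HasDerivAt (fun t => sin (a * t)) (a * cos (a * t)) t := by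
  simpa [mul_comm] using ((hasDerivAt_id t).const_mul a).sin

theorem hasDerivAt_cos_mul (a t : ℝ) :
    HasDerivAt (fun t => cos (a * t)) (-(a * sin (a * t))) t := by
  simpa [mul_comm] using ((hasDerivAt_id t).const_mul a).cos

theorem integral_one_sub_mul_cos {a : ℝ} (ha : a ≠ 0) :
    ∫ t in (0 : ℝ)..1, (1 - t) * cos (a * t) = (1 - cos a) / a ^ 2 := by
  rw [intervalIntegral.integral_eq_sub_of_hasDerivAt
    (f := fun t => (1 - t) * sin (a * t) / a - cos (a * t) / a ^ 2)
    (fun t _ => ?_) (Continuous.intervalIntegrable (by fun_prop) _ _)]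
  · simp
    ring
  · convert! (((((hasDerivAt_id t).const_sub 1).mul (hasDerivAt_sin_mul a t)).div_const a).sub
      ((hasDerivAt_cos_mul a t).div_const (a ^ 2))) using 1
    simp only [id]
    field_simp
    ring

theorem integral_one_sub_sq_mul_cos {a : ℝ} (ha : a ≠ 0) :
    ∫ t in (0 : ℝ)..1, (1 - t) ^ 2 * cos (a * t) = 2 / a ^ 2 - 2 * sin a / a ^ 3 := by
  rw [intervalIntegral.integral_eq_sub_of_hasDerivAt
    (f := fun t => (1 - t) ^ 2 * sin (a * t) / a - 2 * (1 - t) * cos (a * t) / a ^ 2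
      - 2 * sin (a * t) / a ^ 3)
    (fun t _ => ?_) (Continuous.intervalIntegrable (by fun_prop) _ _)]
  · simp
    ring
  · have h := (hasDerivAt_id t).const_sub 1
    convert! ((((h.fun_pow 2).mul (hasDerivAt_sin_mul a t)).div_const a).sub
      (((h.const_mul 2).mul (hasDerivAt_cos_mul a t)).div_const (a ^ 2))).sub
      (((hasDerivAt_sin_mul a t).const_mul 2).div_const (a ^ 3)) using 1
    simp only [id]
    field_simp
    push_cast
    ring

theorem integral_sin_mul {a : ℝ} (ha : a ≠ 0) :
    ∫ t in (0 : ℝ)..1, sin (a * t) = (1 - cos a) / a := by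
  rw [intervalIntegral.integral_eq_sub_of_hasDerivAt (f := fun t => -(cos (a * t) / a))
    (fun t _ => ?_) (Continuous.intervalIntegrable (by fun_prop) _ _)]
  · simp
    ring
  · convert! ((hasDerivAt_cos_mul a t).div_const a).neg using 1
    field_simp

theorem integral_one_sub_mul_sin {a : ℝ} (ha : a ≠ 0) :
    ∫ t in (0 : ℝ)..1, (1 - t) * sin (a * t) = 1 / a - sin a / a ^ 2 := by
  rw [intervalIntegral.integral_eq_sub_of_hasDerivAt
    (f := fun t => -((1 - t) * cos (a * t) / a) - sin (a * t) / a ^ 2)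
    (fun t _ => ?_) (Continuous.intervalIntegrable (by fun_prop) _ _)]
  · simp
    ring
  · convert! ((((hasDerivAt_id t).const_sub 1).mul (hasDerivAt_cos_mul a t)).div_const a).neg.sub
      ((hasDerivAt_sin_mul a t).div_const (a ^ 2)) using 1
    simp only [id]
    field_simp
    ring

theorem integrable_of_bounded_support {f : ℝ → ℝ} (hm : Measurable f) (hb : ∀ t, |f t| ≤ 1)
    (h0 : ∀ t, 1 < |t| → f t = 0) : Integrable f := by
  have : IntegrableOn f (Set.Icc (-1) 1) :=
    IntegrableOn.of_bound (by simp) hm.aestronglyMeasurable 1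
      (Eventually.of_forall fun t => hb t)
  refine (integrableOn_iff_integrable_of_support_subset fun t ht => ?_).1 this
  by_contra hc
  exact ht (h0 t (not_le.1 fun h => hc (abs_le.1 h)))

theorem integrable_tent : Integrable tent :=
  integrable_of_bounded_support continuous_tent.measurable
    (fun t => by rw [abs_of_nonneg (tent_nonneg t)]; exact tent_le_one t)
    fun _ ht => tent_of_one_le ht.le

theorem integral_one_sub_pow_eq (n : ℕ) : ∫ t in (0 : ℝ)..1, (1 - t) ^ n = 1 / (n + 1) := by
  have := intervalIntegral.integral_comp_sub_left (fun t : ℝ => t ^ n) (a := 0) (b := 1) 1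
  simp only [sub_self, sub_zero] at this
  rw [this, integral_pow]
  simp

theorem fourier_tent (x : ℝ) : 𝓕 (fun t => (tent t : ℂ)) x = (H1 x : ℂ) := by
  rw [fourier_of_even integrable_tent (fun _ ht => tent_of_one_le ht.le) tent_neg]
  congr 1
  have : ∫ t in (0 : ℝ)..1, tent t * cos (2 * π * x * t) =
      ∫ t in (0 : ℝ)..1, (1 - t) * cos (2 * π * x * t) := by
    refine intervalIntegral.integral_congr fun t ht => ?_
    rw [Set.uIcc_of_le zero_le_one] at ht
    simp only [tent_of_mem ht.1 ht.2]
  rw [this]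
  rcases eq_or_ne x 0 with rfl | hx
  · have := integral_one_sub_pow_eq 1
    norm_num at this
    simp only [mul_zero, zero_mul, cos_zero, mul_one]
    rw [this]
    simp [H1]
  · rw [integral_one_sub_mul_cos (by positivity), H1_of_ne_zero hx,
      show 2 * π * x = 2 * (π * x) by ring, cos_two_mul, cos_sq']
    field_simp
    ring

/-- Fourier inversion applied to `fourier_tent`; evenness of the tent absorbs the reflection. -/
theorem fourier_H1 (t : ℝ) : 𝓕 (fun x => (H1 x : ℂ)) t = (tent t : ℂ) := by
  have hF : 𝓕 (fun t => (tent t : ℂ)) = fun x => (H1 x : ℂ) := funext fourier_tent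
  have hc : Continuous fun t => (tent t : ℂ) := Complex.continuous_ofReal.comp continuous_tent
  have h := congrFun (hc.fourierInv_fourier_eq (integrable_coe integrable_tent)
    (by rw [hF]; exact (integrable_coe integrable_H1))) (-t)
  rw [hF, fourierInv_eq_fourier_neg, neg_neg, tent_neg] at h
  exact h

theorem integral_H1 : ∫ x, H1 x = 1 := by
  have h := fourier_H1 0
  rw [fourier_real_eq_integral_exp_smul] at h
  simp only [mul_zero, Complex.ofReal_zero, zero_mul, Complex.exp_zero, one_smul] at h
  rw [integral_complex_ofReal] at h
  have h' := Complex.ofReal_injective h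
  simpa [tent] using h'

/-- The integer translates of the Fejér kernel form a partition of unity. -/
theorem hasSum_H1 (x : ℝ) : HasSum (fun n : ℤ => H1 (x - n)) 1 := by
  have hO : (fun x => (H1 x : ℂ)) =O[cocompact ℝ] fun x : ℝ => |x| ^ (-2 : ℝ) := by
    refine Asymptotics.IsBigO.of_bound 1 ?_
    have : ∀ᶠ x : ℝ in cocompact ℝ, x ≠ 0 :=
      (isCompact_singleton (x := (0 : ℝ))).compl_mem_cocompact
    filter_upwards [this] with y hy
    rw [Complex.norm_real, norm_eq_abs, norm_eq_abs, abs_of_nonneg (H1_nonneg y), one_mul,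
      abs_of_nonneg (by positivity), rpow_neg (abs_nonneg y), rpow_two, sq_abs, H1_of_ne_zero hy,
      div_eq_mul_inv]
    exact mul_le_of_le_one_left (by positivity) (sin_div_pi_sq_le_one _)
  -- Only the zero frequency survives on the dual side of Poisson summation.
  have hT : ∀ n : ℤ, n ≠ 0 → 𝓕 (fun x => (H1 x : ℂ)) n = 0 := by
    intro n hn
    rw [fourier_H1, tent_of_one_le, Complex.ofReal_zero]
    exact_mod_cast Int.one_le_abs hn
  have hc : Continuous fun x => (H1 x : ℂ) := Complex.continuous_ofReal.comp continuous_H1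
  have hsum := tsum_eq_tsum_fourier_of_rpow_decay_of_summable hc one_lt_two hO
    (summable_of_ne_finset_zero (s := {0}) fun n hn => hT n (by simpa using hn)) x
  have h0 : 𝓕 (fun x => (H1 x : ℂ)) ((0 : ℤ) : ℝ) = 1 := by
    rw [fourier_H1]
    simp [tent]
  have hsingle : ∑' n : ℤ, 𝓕 (fun x => (H1 x : ℂ)) n * _root_.fourier n (x : UnitAddCircle) = 1 := by
    rw [tsum_eq_single 0 fun n hn => by rw [hT n hn, zero_mul], h0]
    simp
  rw [hsingle] at hsum
  -- Poisson summation yields only an equality of `tsum`s, so convergence of the left side is shown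
  -- separately, by bounding each term by a sup norm over the compact set `{x}`.
  have hS : Summable fun n : ℤ => H1 (x + n) := by
    have := summable_of_isBigO (summable_abs_int_rpow one_lt_two)
      ((isBigO_norm_restrict_cocompact ⟨_, hc⟩ two_pos hO ⟨{x}, isCompact_singleton⟩).comp_tendsto
      Int.tendsto_coe_cofinite)
    refine Summable.of_nonneg_of_le (fun _ => H1_nonneg _) (fun n => ?_) this
    have := ContinuousMap.norm_coe_le_norm (((⟨_, hc⟩ : C(ℝ, ℂ)).comp
      (ContinuousMap.addRight (n : ℝ))).restrict {x}) ⟨x, rfl⟩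
    simpa [abs_of_nonneg (H1_nonneg _)] using this
  have h1 : HasSum (fun n : ℤ => H1 (x + n)) 1 := by
    refine (hS.hasSum_iff).2 ?_
    have : ((∑' n : ℤ, H1 (x + n) : ℝ) : ℂ) = 1 := by
      rw [Complex.ofReal_tsum, hsum]
    exact_mod_cast this
  have := (Equiv.neg ℤ).hasSum_iff.2 h1
  simpa [Function.comp_def, ← sub_eq_add_neg] using this

/-! ### Correlations with the Fejér kernel -/

/-- A shift by `β` is a modulation of `f`; self-adjointness of the Fourier transform then moves it
from `f` onto `H1`, where it produces the tent. -/
theorem integral_fourier_add_mul_H1 {f : ℝ → ℂ} (hf : Integrable f) (β : ℝ) :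
    ∫ x, 𝓕 f (x + β) * (H1 x : ℂ) = 𝓕 (fun t => f t * (tent t : ℂ)) β := by
  set g : ℝ → ℂ := fun t => Complex.exp (((-2 * π * t * β : ℝ) : ℂ) * Complex.I) • f t with hg
  have hgi : Integrable g := by
    refine hf.mono ?_ (Eventually.of_forall fun t => ?_)
    · have hc : Continuous fun t : ℝ => Complex.exp (((-2 * π * t * β : ℝ) : ℂ) * Complex.I) := by
        fun_prop
      exact hc.aestronglyMeasurable.smul hf.aestronglyMeasurable
    · rw [hg, norm_smul, Complex.norm_exp_ofReal_mul_I, one_mul]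
  have hFg : ∀ x, 𝓕 f (x + β) = 𝓕 g x := by
    intro x
    rw [fourier_real_eq_integral_exp_smul, fourier_real_eq_integral_exp_smul]
    refine integral_congr_ae (Eventually.of_forall fun t => ?_)
    simp only [hg, smul_eq_mul]
    rw [← mul_assoc, ← Complex.exp_add]
    congr 2
    push_cast
    ring
  have hflip := VectorFourier.integral_fourierIntegral_smul_eq_flip (L := innerₗ ℝ)
    (μ := volume) (ν := volume) continuous_fourierChar continuous_inner hgi (integrable_coe integrable_H1)
    (F := ℂ)
  rw [flip_innerₗ] at hflip
  simp_rw [hFg]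
  refine hflip.trans ?_
  rw [fourier_real_eq_integral_exp_smul]
  refine integral_congr_ae (Eventually.of_forall fun t => ?_)
  have := fourier_H1 t
  change g t * 𝓕 (fun x => (H1 x : ℂ)) t = _
  rw [this]
  simp only [hg, smul_eq_mul]
  ring

theorem integral_H1_add_mul_H1 (β : ℝ) :
    ∫ x, H1 (x + β) * H1 x = 2 * ∫ t in (0 : ℝ)..1, (1 - t) ^ 2 * cos (2 * π * β * t) := by
  have h := integral_fourier_add_mul_H1 (integrable_coe integrable_tent) β
  simp_rw [fourier_tent] at h
  have hi : Integrable fun t => tent t * tent t :=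
    integrable_of_bounded_support (continuous_tent.mul continuous_tent).measurable
      (fun t => by
        rw [abs_of_nonneg (mul_nonneg (tent_nonneg t) (tent_nonneg t))]
        exact mul_le_one₀ (tent_le_one t) (tent_nonneg t) (tent_le_one t))
      fun _ ht => by rw [tent_of_one_le ht.le, zero_mul]
  have h2 := fourier_of_even hi (fun _ ht => by rw [tent_of_one_le ht.le, zero_mul])
    (fun t => by rw [tent_neg]) β
  simp only [← Complex.ofReal_mul] at h
  rw [h2, integral_complex_ofReal] at h
  rw [Complex.ofReal_injective h]
  congr 1
  refine intervalIntegral.integral_congr fun t ht => ?_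
  rw [Set.uIcc_of_le zero_le_one] at ht
  simp only [tent_of_mem ht.1 ht.2]
  ring

/-- The shift `β - n` enters through its cosine transform, and periodicity removes `n` from the
sine. At zero shift the integral is `2 / 3`, which matches the limiting value `4 * π ^ 2 / 3` of
`kernelTerm`. -/
theorem integral_H1_add_sub_mul_H1 (n : ℤ) (β : ℝ) :
    ∫ x, H1 (x + β - n) * H1 x = 1 / (2 * π ^ 2) * kernelTerm n β := by
  have := integral_H1_add_mul_H1 (β - n)
  simp only [← add_sub_assoc] at this
  rw [this, kernelTerm]
  split_ifs with h
  · subst h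
    have h2 := integral_one_sub_pow_eq 2
    simp only [sub_self, mul_zero, zero_mul, cos_zero, mul_one]
    rw [h2]
    field_simp
    norm_num
  · have hne : β - n ≠ 0 := sub_ne_zero.2 h
    have hne' : n - β ≠ 0 := sub_ne_zero.2 (Ne.symm h)
    rw [integral_one_sub_sq_mul_cos (by positivity),
      show 2 * π * (β - n) = 2 * π * β - n * (2 * π) by ring, sin_sub_int_mul_two_pi,
      show 2 * π * β - n * (2 * π) = -(2 * π * (n - β)) by ring]
    field_simp
    ring

/-- The function `x ↦ x H₁(x)` is, up to a constant, the Fourier transform of this function. -/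
noncomputable def signBox (t : ℝ) : ℝ := if |t| ≤ 1 then Real.sign t else 0

theorem measurable_sign : Measurable Real.sign := by
  unfold Real.sign
  exact Measurable.ite measurableSet_Iio measurable_const
    (Measurable.ite measurableSet_Ioi measurable_const measurable_const)

theorem abs_sign_le_one (x : ℝ) : |Real.sign x| ≤ 1 := by
  rcases Real.sign_apply_eq x with h | h | h <;> simp [h]

theorem signBox_neg (t : ℝ) : signBox (-t) = -signBox t := by
  unfold signBox
  rw [abs_neg, Real.sign_neg]
  split_ifs <;> simp

theorem abs_signBox_le_one (t : ℝ) : |signBox t| ≤ 1 := by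
  unfold signBox
  split_ifs
  · exact abs_sign_le_one t
  · simp

theorem measurable_signBox : Measurable signBox := by
  unfold signBox
  exact Measurable.ite (measurableSet_le measurable_abs measurable_const) measurable_sign
    measurable_const

theorem signBox_of_one_lt {t : ℝ} (ht : 1 < |t|) : signBox t = 0 := if_neg (not_le.2 ht)

theorem signBox_of_mem {t : ℝ} (h0 : 0 < t) (h1 : t ≤ 1) : signBox t = 1 := by
  rw [signBox, if_pos (by rwa [abs_of_pos h0]), Real.sign_of_pos h0]

theorem integrable_signBox : Integrable signBox :=
  integrable_of_bounded_support measurable_signBox abs_signBox_le_one fun _ => signBox_of_one_lt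

theorem fourier_signBox (x : ℝ) :
    𝓕 (fun t => (signBox t : ℂ)) x = ((2 * π * (x * H1 x) : ℝ) : ℂ) * -Complex.I := by
  rw [fourier_of_odd integrable_signBox (fun _ => signBox_of_one_lt) signBox_neg]
  congr 2
  have : ∫ t in (0 : ℝ)..1, signBox t * sin (2 * π * x * t) =
      ∫ t in (0 : ℝ)..1, sin (2 * π * x * t) := by
    refine intervalIntegral.integral_congr fun t ht => ?_
    rw [Set.uIcc_of_le zero_le_one] at ht
    rcases ht.1.eq_or_lt with h | h
    · simp [← h]
    · simp [signBox_of_mem h ht.2]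
  rw [this]
  rcases eq_or_ne x 0 with rfl | hx
  · simp
  · rw [integral_sin_mul (by positivity), H1_of_ne_zero hx,
      show 2 * π * x = 2 * (π * x) by ring, cos_two_mul, cos_sq']
    field_simp
    ring

theorem integral_add_mul_H1_add_mul_H1 {β : ℝ} (hβ : β ≠ 0) :
    ∫ x, (x + β) * H1 (x + β) * H1 x =
      1 / (2 * π ^ 2 * β) - sin (2 * π * β) / (4 * π ^ 3 * β ^ 2) := by
  have h := integral_fourier_add_mul_H1 (integrable_coe integrable_signBox) β
  simp_rw [fourier_signBox] at h
  have h0 : ∀ t, 1 < |t| → signBox t * tent t = 0 := fun t ht => by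
    rw [signBox_of_one_lt ht, zero_mul]
  have hi : Integrable fun t => signBox t * tent t :=
    integrable_of_bounded_support (measurable_signBox.mul continuous_tent.measurable)
      (fun t => by
        rw [abs_mul, abs_of_nonneg (tent_nonneg t)]
        exact mul_le_one₀ (abs_signBox_le_one t) (tent_nonneg t) (tent_le_one t)) h0
  have h2 := fourier_of_odd hi h0 (fun t => by rw [tent_neg, signBox_neg, neg_mul]) β
  simp only [← Complex.ofReal_mul] at h
  have h3 : ∫ t in (0 : ℝ)..1, signBox t * tent t * sin (2 * π * β * t) =
      ∫ t in (0 : ℝ)..1, (1 - t) * sin (2 * π * β * t) := by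
    refine intervalIntegral.integral_congr fun t ht => ?_
    rw [Set.uIcc_of_le zero_le_one] at ht
    rcases ht.1.eq_or_lt with h | h
    · simp [← h]
    · simp [signBox_of_mem h ht.2, tent_of_mem ht.1 ht.2]
  rw [h2, h3, integral_one_sub_mul_sin (by positivity)] at h
  have h4 : ∀ x : ℝ, ((2 * π * ((x + β) * H1 (x + β)) : ℝ) : ℂ) * -Complex.I * (H1 x : ℂ) =
      (((x + β) * H1 (x + β) * H1 x : ℝ) : ℂ) * (((2 * π : ℝ) : ℂ) * -Complex.I) := by
    intro x
    push_cast
    ring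
  simp_rw [h4] at h
  rw [integral_mul_const, integral_complex_ofReal, ← mul_assoc, ← Complex.ofReal_mul] at h
  have h5 := Complex.ofReal_injective (mul_right_cancel₀ (neg_ne_zero.2 Complex.I_ne_zero) h)
  have h6 : ∫ x, (x + β) * H1 (x + β) * H1 x =
      2 * (1 / (2 * π * β) - sin (2 * π * β) / (2 * π * β) ^ 2) / (2 * π) := by
    rw [← h5]
    field_simp
  rw [h6]
  field_simp
  ring

/-! ### Telescoping bounds -/

theorem hasSum_one_div_mul_succ {x : ℝ} (hx : 0 < x) :
    HasSum (fun n : ℕ => 1 / ((x + n) * (x + n + 1))) (1 / x) := by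
  rw [hasSum_iff_tendsto_nat_of_nonneg fun n => by positivity]
  have hsum : ∀ N : ℕ, ∑ n ∈ Finset.range N, 1 / ((x + n) * (x + n + 1)) =
      1 / x - 1 / (x + N) := by
    intro N
    induction N with
    | zero => simp
    | succ N ih =>
      rw [Finset.sum_range_succ, ih]
      push_cast
      have : x + N ≠ 0 := by positivity
      have : x + (N + 1) ≠ 0 := by positivity
      have : x + N + 1 ≠ 0 := by positivity
      field_simp
      ring
  simp_rw [hsum]
  have h : Tendsto (fun N : ℕ => x + (N : ℝ)) atTop atTop :=
    tendsto_atTop_add_const_left _ _ tendsto_natCast_atTop_atTop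
  simpa using (h.inv_tendsto_atTop.const_sub (1 / x))

theorem one_div_add_succ_sq_le {x : ℝ} (hx : 0 < x) (n : ℕ) :
    1 / (x + n + 1) ^ 2 ≤ 1 / ((x + n) * (x + n + 1)) := by
  have : 0 < x + n := by positivity
  exact one_div_le_one_div_of_le (by positivity) (by nlinarith)

theorem summable_one_div_add_succ_sq {x : ℝ} (hx : 0 < x) :
    Summable fun n : ℕ => 1 / (x + n + 1) ^ 2 :=
  Summable.of_nonneg_of_le (fun n => by positivity) (one_div_add_succ_sq_le hx)
    (hasSum_one_div_mul_succ hx).summable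

theorem tsum_one_div_add_succ_sq_le {x : ℝ} (hx : 0 < x) :
    ∑' n : ℕ, 1 / (x + n + 1) ^ 2 ≤ 1 / x := by
  rw [← (hasSum_one_div_mul_succ hx).tsum_eq]
  exact (summable_one_div_add_succ_sq hx).tsum_le_tsum (one_div_add_succ_sq_le hx)
    (hasSum_one_div_mul_succ hx).summable

/-- The telescoping series started at `x + 1` lies termwise below these squares. -/
theorem le_tsum_one_div_add_succ_sq {x : ℝ} (hx : 0 < x) :
    1 / (x + 1) ≤ ∑' n : ℕ, 1 / (x + n + 1) ^ 2 := by
  have h := hasSum_one_div_mul_succ (x := x + 1) (by linarith)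
  rw [← h.tsum_eq]
  refine h.summable.tsum_le_tsum (fun n => ?_) (summable_one_div_add_succ_sq hx)
  have : 0 < x + n := by positivity
  exact one_div_le_one_div_of_le (by positivity) (by nlinarith)

/-! ### The interpolation formula and the approximation of the sign function -/

theorem sin_pi_mul_sub_int_sq (x : ℝ) (n : ℤ) : sin (π * (x - n)) ^ 2 = sin (π * x) ^ 2 := by
  rw [show π * (x - n) = π * x - n * π by ring, sin_sub_int_mul_pi, mul_pow]
  rcases Int.even_or_odd n with h | h
  · simp [h.neg_one_zpow]
  · simp [h.neg_one_zpow]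

theorem H1_sub_int {x : ℝ} {n : ℤ} (h : x - n ≠ 0) :
    H1 (x - n) = (sin (π * x) / π) ^ 2 * (1 / (x - n) ^ 2) := by
  rw [H1_of_ne_zero h, div_pow, sin_pi_mul_sub_int_sq, div_pow]
  ring

theorem H1_intCast (n : ℤ) : H1 n = if n = 0 then 1 else 0 := by
  split_ifs with h
  · simp [h, H1]
  · rw [H1_of_ne_zero (Int.cast_ne_zero.2 h), mul_comm π, sin_int_mul_pi]
    simp

theorem summable_mul_H1 {c : ℤ → ℝ} (hc : ∀ n, |c n| ≤ 1) (x : ℝ) :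
    Summable fun n : ℤ => c n * H1 (x - n) := by
  refine Summable.of_norm_bounded (hasSum_H1 x).summable fun n => ?_
  rw [norm_eq_abs, abs_mul, abs_of_nonneg (H1_nonneg _)]
  exact mul_le_of_le_one_left (H1_nonneg _) (hc n)

/-- Off the integers this is the definition of `H0` with the sine factor distributed over the
series. At an integer `k` only the term `n = k` remains and `2 * k * H1 k = 0`, in agreement with
the value assigned to `H0` there. -/
theorem hasSum_sign_mul_H1 (x : ℝ) :
    HasSum (fun n : ℤ => Real.sign n * H1 (x - n)) (H0 x - 2 * x * H1 x) := by
  refine ((summable_mul_H1 (fun n => abs_sign_le_one n) x).hasSum_iff).2 ?_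
  by_cases h : ∃ k : ℤ, x = k
  · rw [H0, if_pos h]
    obtain ⟨k, rfl⟩ := h
    rw [tsum_eq_single k]
    · rcases eq_or_ne k 0 with rfl | hk
      · simp
      · rw [H1_intCast k, if_neg hk]
        simp [H1]
    · intro n hn
      rw [← Int.cast_sub, H1_intCast, if_neg (sub_ne_zero.2 (Ne.symm hn)), mul_zero]
  · have hne : ∀ n : ℤ, x - n ≠ 0 := fun n hn => h ⟨n, by linarith⟩
    have hx : x ≠ 0 := by simpa using hne 0
    rw [H0, if_neg h, H1_of_ne_zero hx]
    have : ∀ n : ℤ, Real.sign n * H1 (x - n) =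
        (sin (π * x) / π) ^ 2 * (Real.sign n / (x - n) ^ 2) := by
      intro n
      rw [H1_sub_int (hne n)]
      ring
    simp_rw [this]
    rw [tsum_mul_left]
    field_simp
    ring

theorem H0_neg (x : ℝ) : H0 (-x) = -H0 x := by
  have h1 := (Equiv.neg ℤ).hasSum_iff.2 (hasSum_sign_mul_H1 (-x))
  have h2 := (hasSum_sign_mul_H1 x).neg
  have : (fun n : ℤ => -(Real.sign n * H1 (x - n))) =
      (fun n : ℤ => Real.sign n * H1 (-x - n)) ∘ Equiv.neg ℤ := by
    funext n
    simp only [Function.comp_apply, Equiv.neg_apply, Int.cast_neg, Real.sign_neg]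
    rw [show -x - -(n : ℝ) = -(x - n) by ring, H1_neg]
    ring
  rw [this] at h2
  have := h1.unique h2
  rw [H1_neg] at this
  linarith

/-- Subtracting the interpolation series from the partition of unity leaves weight 2 on negative
`n`, weight 1 at `n = 0` and nothing on positive `n`. So `H0 x - 1 = S * (2 / x - 1 / x ^ 2 - 2 *
A)`, and the telescoping bounds `1 / (x + 1) ≤ A ≤ 1 / x` confine the bracket to `± 1 / x ^ 2`. -/
theorem abs_H0_sub_one_le {x : ℝ} (hx : 0 < x) : |H0 x - 1| ≤ H1 x := by
  set S := (sin (π * x) / π) ^ 2 with hS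
  set A := ∑' n : ℕ, 1 / (x + n + 1) ^ 2 with hA
  have hneg : HasSum (fun n : ℕ => (1 - Real.sign ((-((n : ℤ) + 1) : ℤ) : ℝ)) *
      H1 (x - (-((n : ℤ) + 1) : ℤ))) (2 * S * A) := by
    convert! (summable_one_div_add_succ_sq hx).hasSum.mul_left (2 * S) using 2 with n
    have h1 : x - (-((n : ℤ) + 1) : ℤ) = x + n + 1 := by
      push_cast
      ring
    have h2 : Real.sign ((-((n : ℤ) + 1) : ℤ) : ℝ) = -1 := by
      refine Real.sign_of_neg ?_
      push_cast
      linarith [(Nat.cast_nonneg n : (0 : ℝ) ≤ n)]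
    have h3 : x + n + 1 ≠ 0 := by positivity
    rw [H1_sub_int (by rwa [h1]), h1, h2]
    ring
  have hpos : HasSum (fun n : ℕ => (1 - Real.sign ((n : ℤ) : ℝ)) * H1 (x - (n : ℤ))) (H1 x) := by
    convert! hasSum_single (f := fun n : ℕ => (1 - Real.sign ((n : ℤ) : ℝ)) * H1 (x - (n : ℤ))) 0
      (fun n hn => ?_) using 1
    · simp
    · have : (0 : ℝ) < n := by exact_mod_cast Nat.pos_of_ne_zero hn
      simp [Real.sign_of_pos this]
  have htot := (hasSum_H1 x).sub (hasSum_sign_mul_H1 x)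
  have heq := (HasSum.of_nat_of_neg_add_one (f := fun n : ℤ => (1 - Real.sign n) * H1 (x - n))
    hpos hneg).unique (htot.congr_fun fun n => by ring)
  have h1 : H1 x = S * (1 / x ^ 2) := by rw [H1_of_ne_zero hx.ne']; ring
  have hS0 : 0 ≤ S := sq_nonneg _
  have hdiff : H0 x - 1 = S * (2 / x - 1 / x ^ 2 - 2 * A) := by
    have : 2 * x * H1 x = S * (2 / x) := by
      rw [h1]
      field_simp
    linarith
  have hu := tsum_one_div_add_succ_sq_le hx
  have hl := le_tsum_one_div_add_succ_sq hx
  rw [← hA] at hu hl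
  have hl' : 2 / x - 2 * (1 / (x + 1)) ≤ 2 * (1 / x ^ 2) := by
    have : 2 / x - 2 * (1 / (x + 1)) = 2 * (1 / (x * (x + 1))) := by
      field_simp
      ring
    rw [this]
    gcongr
    nlinarith
  have h2x : 2 / x = 2 * (1 / x) := by ring
  rw [hdiff, abs_mul, abs_of_nonneg hS0, h1]
  refine mul_le_mul_of_nonneg_left (abs_le.2 ⟨?_, ?_⟩) hS0 <;> linarith

theorem abs_H0_sub_sign_le (x : ℝ) : |H0 x - Real.sign x| ≤ H1 x := by
  rcases lt_trichotomy x 0 with h | rfl | h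
  · have := abs_H0_sub_one_le (neg_pos.2 h)
    rw [H0_neg, H1_neg, ← abs_neg] at this
    rwa [Real.sign_of_neg h, show H0 x - -1 = -(-H0 x - 1) by ring]
  · have : H0 0 = 0 := by
      have := H0_neg 0
      rw [neg_zero] at this
      linarith
    simp [this, H1_nonneg]
  · rw [Real.sign_of_pos h]
    exact abs_H0_sub_one_le h

/-- Up to a continuous function, `H0` is a pointwise limit of finite sums of continuous functions.
-/
theorem aestronglyMeasurable_H0 : AEStronglyMeasurable H0 := by
  have h : AEStronglyMeasurable fun x => H0 x - 2 * x * H1 x := by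
    refine aestronglyMeasurable_of_tendsto_ae (atTop : Filter (Finset ℤ))
      (f := fun s x => ∑ n ∈ s, Real.sign n * H1 (x - n)) (fun s => ?_)
      (Eventually.of_forall fun x => hasSum_sign_mul_H1 x)
    have := continuous_H1
    exact Continuous.aestronglyMeasurable (by fun_prop)
  have h2 : AEStronglyMeasurable fun x => 2 * x * H1 x := by
    have := continuous_H1
    exact Continuous.aestronglyMeasurable (by fun_prop)
  exact (h.add h2).congr (Eventually.of_forall fun x => sub_add_cancel _ _)

theorem integrable_H0_sub_sign : Integrable fun x => H0 x - Real.sign x :=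
  integrable_H1.mono'
    (aestronglyMeasurable_H0.sub measurable_sign.aestronglyMeasurable)
    (Eventually.of_forall abs_H0_sub_sign_le)

theorem integral_H0_sub_sign : ∫ x, (H0 x - Real.sign x) = 0 := by
  have h := integral_neg_eq_self (fun x => H0 x - Real.sign x) volume
  simp_rw [H0_neg, Real.sign_neg] at h
  have h2 : ∫ x, (-H0 x - -Real.sign x) = -∫ x, (H0 x - Real.sign x) := by
    rw [← integral_neg]
    congr 1
    funext x
    ring
  linarith

theorem integrable_H_sub_sign (s : ℝ) : Integrable fun x => H s x - Real.sign x := by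
  refine (integrable_H0_sub_sign.add (integrable_H1.const_mul s)).congr
    (Eventually.of_forall fun x => ?_)
  simp only [H, Pi.add_apply]
  ring

theorem integral_H_sub_sign (s : ℝ) : ∫ x, (H s x - Real.sign x) = s := by
  have : ∀ x, H s x - Real.sign x = (H0 x - Real.sign x) + s * H1 x := fun x => by
    simp only [H]
    ring
  simp_rw [this]
  rw [integral_add integrable_H0_sub_sign (integrable_H1.const_mul s), integral_H0_sub_sign,
    integral_const_mul, integral_H1]
  ring

/-- Equality fails only at `β` and `-β`, where the left side is `1 / 2`. -/
theorem sign_add_sign_ae_eq (β : ℝ) (hβ : 0 < β) :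
    (fun x => (Real.sign (x + β) + Real.sign (-x + β)) / 2) =ᵐ[volume]
      (Set.Ioo (-β) β).indicator 1 := by
  have h1 : ∀ᵐ x : ℝ, x ≠ β := by simp [ae_iff, measure_singleton]
  have h2 : ∀ᵐ x : ℝ, x ≠ -β := by simp [ae_iff, measure_singleton]
  filter_upwards [h1, h2] with x hx1 hx2
  rcases lt_or_gt_of_ne hx1 with h1 | h1 <;> rcases lt_or_gt_of_ne hx2 with h2 | h2
  · rw [Real.sign_of_neg (by linarith), Real.sign_of_pos (by linarith),
      Set.indicator_of_notMem fun h => h2.not_gt h.1]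
    norm_num
  · rw [Real.sign_of_pos (by linarith), Real.sign_of_pos (by linarith),
      Set.indicator_of_mem (Set.mem_Ioo.2 ⟨h2, h1⟩)]
    norm_num
  · linarith
  · rw [Real.sign_of_pos (by linarith), Real.sign_of_neg (by linarith),
      Set.indicator_of_notMem fun h => h1.not_gt h.2]
    norm_num

theorem integrable_r_and_integral_r (s : ℝ) {β : ℝ} (hβ : 0 < β) :
    Integrable (r s β) ∧ ∫ x, r s β x = 2 * β + s := by
  have hD := integrable_H_sub_sign s
  have hD1 : Integrable fun x => H s (x + β) - Real.sign (x + β) := hD.comp_add_right β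
  have hD2 : Integrable fun x => H s (-x + β) - Real.sign (-x + β) := hD1.comp_neg
  have hI1 : ∫ x, (H s (x + β) - Real.sign (x + β)) = s := by
    rw [integral_add_right_eq_self fun x => H s x - Real.sign x, integral_H_sub_sign]
  have hI2 : ∫ x, (H s (-x + β) - Real.sign (-x + β)) = s := by
    rw [integral_neg_eq_self fun x => H s (x + β) - Real.sign (x + β), hI1]
  have hind : Integrable ((Set.Ioo (-β) β).indicator (1 : ℝ → ℝ)) :=
    (integrable_indicator_iff measurableSet_Ioo).2 (integrableOn_const (by simp))
  have hχ := hind.congr (sign_add_sign_ae_eq β hβ).symm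
  have hIχ : ∫ x, (Real.sign (x + β) + Real.sign (-x + β)) / 2 = 2 * β := by
    rw [integral_congr_ae (sign_add_sign_ae_eq β hβ), integral_indicator_one measurableSet_Ioo,
      volume_real_Ioo_of_le (by linarith)]
    ring
  have hr : r s β = fun x => ((H s (x + β) - Real.sign (x + β)) +
      (H s (-x + β) - Real.sign (-x + β))) / 2 +
      (Real.sign (x + β) + Real.sign (-x + β)) / 2 := by
    funext x
    simp only [r]
    ring
  have hsum : Integrable fun x => ((H s (x + β) - Real.sign (x + β)) +
      (H s (-x + β) - Real.sign (-x + β))) / 2 := (hD1.add hD2).div_const 2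
  rw [hr]
  refine ⟨hsum.add hχ, ?_⟩
  rw [integral_add hsum hχ, hIχ, integral_div, integral_add hD1 hD2, hI1, hI2]
  ring

/-! ### Integration against the Fejér kernel -/

theorem hasSum_sgnPM_mul_H1 (s x : ℝ) :
    HasSum (fun n : ℤ => sgnPM s n * H1 (x - n)) (H s x - 2 * x * H1 x) := by
  have h := (hasSum_sign_mul_H1 x).add (hasSum_ite_eq (0 : ℤ) (s * H1 x))
  convert! h using 1
  · funext n
    rcases eq_or_ne n 0 with rfl | hn
    · simp [sgnPM]
    · simp [sgnPM, hn]
  · simp only [H]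
    ring

theorem abs_sgnPM_le_one {s : ℝ} (hs : |s| ≤ 1) (n : ℤ) : |sgnPM s n| ≤ 1 := by
  unfold sgnPM
  split_ifs
  · exact hs
  · exact abs_sign_le_one _

/-- Termwise integration is justified by dominated convergence: the dominating series `∑ H1 (x + β -
n) * H1 x` sums to the integrable function `H1 x`. -/
theorem hasSum_integral_mul_H1 {c : ℤ → ℝ} (hc : ∀ n, |c n| ≤ 1) {g : ℝ → ℝ}
    (hg : ∀ x, HasSum (fun n : ℤ => c n * H1 (x - n)) (g x)) (β : ℝ) :
    HasSum (fun n : ℤ => 1 / (2 * π ^ 2) * (c n * kernelTerm n β))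
      (∫ x, g (x + β) * H1 x) := by
  have hcont := continuous_H1
  have h := hasSum_integral_of_dominated_convergence (μ := volume)
    (F := fun (n : ℤ) x => c n * H1 (x + β - n) * H1 x) (f := fun x => g (x + β) * H1 x)
    (fun (n : ℤ) x => H1 (x + β - n) * H1 x)
    (fun n => Continuous.aestronglyMeasurable (by fun_prop))
    (fun n => Eventually.of_forall fun x => ?_)
    (Eventually.of_forall fun x => ((hasSum_H1 (x + β)).mul_right (H1 x)).summable) ?_
    (Eventually.of_forall fun x => (hg (x + β)).mul_right (H1 x))
  · convert! h using 1
    funext n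
    simp_rw [mul_assoc (c n)]
    rw [integral_const_mul, integral_H1_add_sub_mul_H1]
    ring
  · rw [norm_eq_abs, mul_assoc, abs_mul,
      abs_of_nonneg (mul_nonneg (H1_nonneg (x + β - n)) (H1_nonneg x))]
    exact mul_le_of_le_one_left (mul_nonneg (H1_nonneg _) (H1_nonneg _)) (hc n)
  · refine integrable_H1.congr (Eventually.of_forall fun x => ?_)
    simp only [((hasSum_H1 (x + β)).mul_right (H1 x)).tsum_eq, one_mul]

/-- The case of all coefficients equal to 1, where the interpolated function is the constant 1 and
`∫ H1 = 1`. -/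
theorem hasSum_kernelTerm (β : ℝ) : HasSum (fun n : ℤ => kernelTerm n β) (2 * π ^ 2) := by
  have h := (hasSum_integral_mul_H1 (c := fun _ => 1) (g := fun _ => 1) (fun n => by simp)
    (fun x => by simpa using hasSum_H1 x) β).mul_left (2 * π ^ 2)
  simp only [one_mul, integral_H1, mul_one] at h
  convert! h using 1
  funext n
  field_simp

theorem abs_mul_H1_le_one (x : ℝ) : |x * H1 x| ≤ 1 := by
  rw [← sq_le_one_iff_abs_le_one, mul_pow]
  have h1 : x ^ 2 * H1 x ≤ 1 := (sq_mul_H1 x).trans_le (sin_div_pi_sq_le_one _)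
  nlinarith [H1_nonneg x, H1_le_one x, mul_nonneg (sq_nonneg x) (H1_nonneg x)]

theorem abs_H_le {s : ℝ} (hs : |s| ≤ 1) (x : ℝ) : |H s x| ≤ 3 := by
  have h0 := abs_le.1 (abs_H0_sub_sign_le x)
  have h1 := abs_le.1 (abs_sign_le_one x)
  have h2 := abs_le.1 hs
  have h3 := H1_le_one x
  have h4 := H1_nonneg x
  rw [H, abs_le]
  constructor <;> nlinarith

theorem integrable_H_add_mul_H1 {s : ℝ} (hs : |s| ≤ 1) (β : ℝ) :
    Integrable fun x => H s (x + β) * H1 x := by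
  have hH : AEStronglyMeasurable (H s) :=
    aestronglyMeasurable_H0.add (continuous_H1.aestronglyMeasurable.const_mul s)
  exact integrable_H1.bdd_mul (c := 3)
    (hH.comp_measurePreserving (measurePreserving_add_right volume β))
    (Eventually.of_forall fun x => abs_H_le hs _)

theorem integrable_add_mul_H1_add_mul_H1 (β : ℝ) :
    Integrable fun x => (x + β) * H1 (x + β) * H1 x := by
  have := continuous_H1
  exact integrable_H1.bdd_mul (c := 1) (Continuous.aestronglyMeasurable (by fun_prop))
    (Eventually.of_forall fun x => abs_mul_H1_le_one _)

theorem hasSum_sgnPM_mul_kernelTerm {s : ℝ} (hs : |s| ≤ 1) {β : ℝ} (hβ : β ≠ 0) :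
    HasSum (fun n : ℤ => sgnPM s n * kernelTerm n β)
      (2 * π ^ 2 * ((∫ x, H s (x + β) * H1 x) -
        2 * (1 / (2 * π ^ 2 * β) - sin (2 * π * β) / (4 * π ^ 3 * β ^ 2)))) := by
  have h := (hasSum_integral_mul_H1 (abs_sgnPM_le_one hs) (hasSum_sgnPM_mul_H1 s) β).mul_left
    (2 * π ^ 2)
  have hI : ∫ x, (H s (x + β) - 2 * (x + β) * H1 (x + β)) * H1 x =
      (∫ x, H s (x + β) * H1 x) -
        2 * (1 / (2 * π ^ 2 * β) - sin (2 * π * β) / (4 * π ^ 3 * β ^ 2)) := by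
    rw [← integral_add_mul_H1_add_mul_H1 hβ, ← integral_const_mul,
      ← integral_sub (integrable_H_add_mul_H1 hs β)
        ((integrable_add_mul_H1_add_mul_H1 β).const_mul 2)]
    congr 1
    funext x
    ring
  rw [hI] at h
  convert! h using 1
  funext n
  field_simp

theorem M_r {s : ℝ} (hs : |s| ≤ 1) {β : ℝ} (hβ : 0 < β) :
    M (r s β) = 2 * β + s - ∫ x, H s (x + β) * H1 x := by
  obtain ⟨hri, hrI⟩ := integrable_r_and_integral_r s hβ
  have h1 := integrable_H_add_mul_H1 hs β
  have h2 : Integrable fun x => H s (-x + β) * H1 x := by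
    simpa only [H1_neg] using h1.comp_neg
  have h3 : ∫ x, H s (-x + β) * H1 x = ∫ x, H s (x + β) * H1 x := by
    rw [← integral_neg_eq_self fun x => H s (x + β) * H1 x]
    simp only [H1_neg]
  have h4 : ∀ x, r s β x * (1 - sinc (π * x) ^ 2) =
      r s β x - (H s (x + β) * H1 x + H s (-x + β) * H1 x) / 2 := fun x => by
    simp only [r, H1]
    ring
  simp_rw [M, h4]
  have h5 : Integrable fun x => (H s (x + β) * H1 x + H s (-x + β) * H1 x) / 2 :=
    (h1.add h2).div_const 2
  rw [integral_sub hri h5, hrI, integral_div, integral_add h1 h2, h3]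
  ring

theorem half_M_r {s : ℝ} (hs : |s| ≤ 1) {β : ℝ} (hβ : 0 < β) :
    1 / 2 * M (r s β) =
      (β + s * (1 / 2)) - 1 / (2 * π ^ 2 * β) + sin (2 * π * β) / (4 * π ^ 3 * β ^ 2)
        - 1 / (4 * π ^ 2) * ∑' n : ℤ, sgnPM s n * kernelTerm n β := by
  rw [M_r hs hβ, (hasSum_sgnPM_mul_kernelTerm hs hβ.ne').tsum_eq]
  field_simp
  ring

/-! ### The asymptotic formula -/

theorem kernelTerm_of_ne {n : ℤ} {β : ℝ} (h : n - β ≠ 0) :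
    kernelTerm n β = 1 / (n - β) ^ 2 * (2 + sin (2 * π * β) / (π * (n - β))) :=
  if_neg fun hc => h (sub_eq_zero.2 hc.symm)

theorem abs_kernelTerm_neg_sub_le {β : ℝ} (hβ : 0 < β) {m : ℕ} :
    |kernelTerm (-((m : ℤ) + 1)) β - 2 * (1 / (β + m + 1) ^ 2)| ≤
      1 / β * (1 / (β + m + 1) ^ 2) := by
  have hcast : ((-((m : ℤ) + 1) : ℤ) : ℝ) - β = -(β + m + 1) := by
    push_cast
    ring
  have hy : 0 < β + m + 1 := by positivity
  have hβy : β ≤ β + m + 1 := by linarith [(Nat.cast_nonneg m : (0 : ℝ) ≤ m)]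
  rw [kernelTerm_of_ne (by rw [hcast]; exact neg_ne_zero.2 hy.ne'), hcast]
  set y := β + m + 1
  have : 1 / (-y) ^ 2 * (2 + sin (2 * π * β) / (π * -y)) - 2 * (1 / y ^ 2) =
      -(sin (2 * π * β) / (π * y)) * (1 / y ^ 2) := by
    field_simp
    ring
  rw [this, abs_mul, abs_of_pos (by positivity : 0 < 1 / y ^ 2), abs_neg, abs_div,
    abs_of_pos (by positivity : 0 < π * y)]
  refine mul_le_mul_of_nonneg_right ?_ (by positivity)
  refine div_le_div₀ zero_le_one (abs_sin_le_one _) hβ ?_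
  nlinarith [pi_gt_three]

/-- Using `|sin y| ≤ |y|` rather than `|sin y| ≤ 1` keeps the bound of order `1 / β ^ 2` even as `β`
tends to 0. -/
theorem abs_kernelTerm_zero_le {β : ℝ} (hβ : 0 < β) : |kernelTerm 0 β| ≤ 4 / β ^ 2 := by
  rw [kernelTerm_of_ne (by simpa using hβ.ne')]
  have h := abs_sin_le_abs (x := 2 * π * β)
  rw [abs_of_pos (by positivity : 0 < 2 * π * β)] at h
  have h2 : |sin (2 * π * β) / (π * (((0 : ℤ) : ℝ) - β))| ≤ 2 := by
    rw [abs_div, Int.cast_zero, zero_sub, mul_neg, abs_neg,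
      abs_of_pos (by positivity : 0 < π * β), div_le_iff₀ (by positivity)]
    linarith
  rw [abs_mul, Int.cast_zero, zero_sub, neg_sq, abs_of_pos (by positivity : 0 < 1 / β ^ 2)]
  rw [Int.cast_zero, zero_sub] at h2
  have h3 : |2 + sin (2 * π * β) / (π * -β)| ≤ 4 := by
    have := abs_le.1 h2
    rw [abs_le]
    constructor <;> linarith
  calc 1 / β ^ 2 * |2 + sin (2 * π * β) / (π * -β)| ≤ 1 / β ^ 2 * 4 := by gcongr
    _ = 4 / β ^ 2 := by ring

theorem exists_hasSum_kernelTerm_neg {β : ℝ} (hβ : 0 < β) :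
    ∃ T, HasSum (fun m : ℕ => kernelTerm (-((m : ℤ) + 1)) β) T ∧ |T - 2 / β| ≤ 3 / β ^ 2 := by
  have hA := summable_one_div_add_succ_sq hβ
  have hu := tsum_one_div_add_succ_sq_le hβ
  have hl := le_tsum_one_div_add_succ_sq hβ
  set A := ∑' m : ℕ, 1 / (β + m + 1) ^ 2
  have hd : Summable fun m : ℕ => kernelTerm (-((m : ℤ) + 1)) β - 2 * (1 / (β + m + 1) ^ 2) :=
    Summable.of_norm_bounded (hA.mul_left (1 / β)) fun m => abs_kernelTerm_neg_sub_le hβ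
  have hdn := tsum_of_norm_bounded (hA.hasSum.mul_left (1 / β))
    (f := fun m : ℕ => kernelTerm (-((m : ℤ) + 1)) β - 2 * (1 / (β + m + 1) ^ 2))
    fun m => abs_kernelTerm_neg_sub_le (m := m) hβ
  set E := ∑' m : ℕ, (kernelTerm (-((m : ℤ) + 1)) β - 2 * (1 / (β + m + 1) ^ 2)) with hE
  -- The constant 3 splits as 1 from the sine corrections collected in `E` and 2 from replacing `2 *
  -- A` by `2 / β`.
  refine ⟨E + 2 * A, (hd.hasSum.add (hA.hasSum.mul_left 2)).congr_fun fun m => by ring, ?_⟩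
  have h1 : 1 / β * A ≤ 1 / β ^ 2 := by
    calc 1 / β * A ≤ 1 / β * (1 / β) := by gcongr
      _ = 1 / β ^ 2 := by ring
  have h2 : 1 / β - 1 / (β + 1) ≤ 1 / β ^ 2 := by
    have : 1 / β - 1 / (β + 1) = 1 / (β * (β + 1)) := by
      field_simp
      ring
    rw [this]
    exact one_div_le_one_div_of_le (by positivity) (by nlinarith)
  have h3 := abs_le.1 (hdn.trans h1)
  have h4 : 3 / β ^ 2 = 3 * (1 / β ^ 2) := by ring
  have h5 : 2 / β = 2 * (1 / β) := by ring
  have h6 : 0 ≤ 1 / β ^ 2 := by positivity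
  rw [abs_le, h4, h5]
  constructor <;> linarith

/-- The weights `1 - sgnPM s n` are 2 for negative `n`, `1 - s` at 0 and 0 for positive `n`, so the
terms near the singularity `n = β` enter only through the full sum `2 * π ^ 2`. -/
theorem tsum_sgnPM_mul_kernelTerm {s : ℝ} (hs : |s| ≤ 1) {β : ℝ} (hβ : 0 < β) {T : ℝ}
    (hT : HasSum (fun m : ℕ => kernelTerm (-((m : ℤ) + 1)) β) T) :
    ∑' n : ℤ, sgnPM s n * kernelTerm n β = 2 * π ^ 2 - 2 * T - (1 - s) * kernelTerm 0 β := by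
  have hneg : HasSum (fun m : ℕ => (1 - sgnPM s (-((m : ℤ) + 1))) *
      kernelTerm (-((m : ℤ) + 1)) β) (2 * T) := by
    convert! hT.mul_left 2 using 2 with m
    have hm : (-((m : ℤ) + 1)) ≠ 0 := by omega
    have hlt : ((-((m : ℤ) + 1) : ℤ) : ℝ) < 0 := by
      push_cast
      linarith [(Nat.cast_nonneg m : (0 : ℝ) ≤ m)]
    rw [sgnPM, if_neg hm, Real.sign_of_neg hlt]
    ring
  have hpos : HasSum (fun m : ℕ => (1 - sgnPM s (m : ℤ)) * kernelTerm (m : ℤ) β)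
      ((1 - s) * kernelTerm 0 β) := by
    convert! hasSum_single (f := fun m : ℕ => (1 - sgnPM s (m : ℤ)) * kernelTerm (m : ℤ) β) 0
      (fun m hm => by
        have : (0 : ℝ) < m := by exact_mod_cast Nat.pos_of_ne_zero hm
        simp [sgnPM, hm, Real.sign_of_pos this]) using 1
  have hS := (hasSum_sgnPM_mul_kernelTerm hs hβ.ne').summable.hasSum
  have htot := (hasSum_kernelTerm β).sub hS
  have := (HasSum.of_nat_of_neg_add_one
    (f := fun n : ℤ => (1 - sgnPM s n) * kernelTerm n β) hpos hneg).unique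
    (htot.congr_fun fun n => by ring)
  linarith

theorem abs_half_M_r_sub_le {s : ℝ} (hs : |s| ≤ 1) {β : ℝ} (hβ : 0 < β) :
    |1 / 2 * M (r s β) - (β - 1 / 2 + s * (1 / 2) + 1 / (2 * π ^ 2 * β))| ≤ 4 / β ^ 2 := by
  obtain ⟨T, hT, hTb⟩ := exists_hasSum_kernelTerm_neg hβ
  rw [half_M_r hs hβ, tsum_sgnPM_mul_kernelTerm hs hβ hT]
  have hpi := pi_gt_three
  -- The main part `2 / β` of `T` contributes `1 / (π ^ 2 * β)`, which reverses the sign of `-1 / (2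
  -- * π ^ 2 * β)`.
  have hid : (β + s * (1 / 2)) - 1 / (2 * π ^ 2 * β) + sin (2 * π * β) / (4 * π ^ 3 * β ^ 2)
      - 1 / (4 * π ^ 2) * (2 * π ^ 2 - 2 * T - (1 - s) * kernelTerm 0 β)
      - (β - 1 / 2 + s * (1 / 2) + 1 / (2 * π ^ 2 * β)) =
      sin (2 * π * β) / (4 * π ^ 3) * (1 / β ^ 2) + 1 / (2 * π ^ 2) * (T - 2 / β)
        + (1 - s) / (4 * π ^ 2) * kernelTerm 0 β := by
    field_simp
    ring
  have hpi2 : (1 : ℝ) ≤ π ^ 2 := one_le_pow₀ (by linarith)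
  have hpi3 : (1 : ℝ) ≤ π ^ 3 := one_le_pow₀ (by linarith)
  have h1 : |sin (2 * π * β) / (4 * π ^ 3) * (1 / β ^ 2)| ≤ 1 / 4 * (1 / β ^ 2) := by
    rw [abs_mul, abs_of_pos (by positivity : 0 < 1 / β ^ 2), abs_div,
      abs_of_pos (by positivity : 0 < 4 * π ^ 3)]
    refine mul_le_mul_of_nonneg_right (div_le_div₀ zero_le_one (abs_sin_le_one _) ?_ ?_) ?_
    · norm_num
    · linarith
    · positivity
  have h2 : |1 / (2 * π ^ 2) * (T - 2 / β)| ≤ 1 / 2 * (3 / β ^ 2) := by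
    rw [abs_mul, abs_of_pos (by positivity : 0 < 1 / (2 * π ^ 2))]
    refine mul_le_mul (one_div_le_one_div_of_le two_pos (by linarith)) hTb (abs_nonneg _) ?_
    norm_num
  have h3 : |(1 - s) / (4 * π ^ 2) * kernelTerm 0 β| ≤ 1 / 2 * (4 / β ^ 2) := by
    rw [abs_mul, abs_div, abs_of_pos (by positivity : 0 < 4 * π ^ 2)]
    refine mul_le_mul ?_ (abs_kernelTerm_zero_le hβ) (abs_nonneg _) (by norm_num)
    rw [div_le_iff₀ (by positivity)]
    have := abs_le.1 hs
    rw [abs_of_nonneg (by linarith)]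
    linarith
  rw [hid]
  -- The three errors total `1 / 4 + 3 / 2 + 2 = 15 / 4`, below 4.
  refine (abs_add_three _ _ _).trans ((add_le_add_three h1 h2 h3).trans ?_)
  have h4 : 0 ≤ 1 / β ^ 2 := by positivity
  have h5 : 3 / β ^ 2 = 3 * (1 / β ^ 2) := by ring
  have h6 : 4 / β ^ 2 = 4 * (1 / β ^ 2) := by ring
  rw [h5, h6]
  linarith

end BeurlingSelberg

theorem theorem2 :
    (∀ s : ℝ, s = 1 ∨ s = -1 → ∀ β : ℝ, 0 < β →
      MeasureTheory.Integrable (BeurlingSelberg.r s β) ∧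
      Summable (fun n : ℤ => BeurlingSelberg.sgnPM s n * BeurlingSelberg.kernelTerm n β) ∧
      1 / 2 * BeurlingSelberg.M (BeurlingSelberg.r s β) =
        (β + s * (1 / 2)) - 1 / (2 * Real.pi ^ 2 * β)
          + Real.sin (2 * Real.pi * β) / (4 * Real.pi ^ 3 * β ^ 2)
          - 1 / (4 * Real.pi ^ 2) *
            ∑' n : ℤ, BeurlingSelberg.sgnPM s n * BeurlingSelberg.kernelTerm n β) ∧
    (∃ C : ℝ, ∀ s : ℝ, s = 1 ∨ s = -1 → ∀ β : ℝ, 0 < β →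
      |1 / 2 * BeurlingSelberg.M (BeurlingSelberg.r s β)
        - (β - 1 / 2 + s * (1 / 2) + 1 / (2 * Real.pi ^ 2 * β))| ≤ C / β ^ 2) := by
  have habs : ∀ s : ℝ, s = 1 ∨ s = -1 → |s| ≤ 1 := by
    rintro s (rfl | rfl) <;> simp
  refine ⟨fun s hs β hβ => ⟨?_, ?_, ?_⟩, 4, fun s hs β hβ => ?_⟩
  · exact (BeurlingSelberg.integrable_r_and_integral_r s hβ).1
  · exact (BeurlingSelberg.hasSum_sgnPM_mul_kernelTerm (habs s hs) hβ.ne').summable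
  · exact BeurlingSelberg.half_M_r (habs s hs) hβ
  · exact BeurlingSelberg.abs_half_M_r_sub_le (habs s hs) hβ
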